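/- Let $\mu\in\mathbb{R}$ and let $F(a,b;c;x)$ denote the Gauss hypergeometric function. For $\Re s>1$ and $u>0$, $u\neq 1$, put \[ G_s(u)=\begin{cases} u^{2i\mu}\,F\left(\tfrac{s}{2}+i\mu,\tfrac12+i\mu;\tfrac{s}{2}+\tfrac12;u^2\right), & 0<u<1,\\ u^{-s}\,F\left(\tfrac{s}{2}+i\mu,\tfrac12+i\mu;\tfrac{s}{2}+\tfrac12;u^{-2}\right), & u>1. \end{cases} \] We say that a function $V:(0,\infty)\to\mathbb{C}$ has a $\bigstar$ transform if there are $\sigma>1$ and a measurable function $V^\bigstar:\sigma+i\mathbb{R}\to\mathbb{C}$ such that \[ \int_{(\sigma)}|s|^{3/2+\epsilon}\,|V^\bigstar(s)|\,|ds|<\infty\quad\text{for some }\epsilon>0, \] and \[ V(u)=\frac{1}{2\pi i}\int_{(\sigma)}V^\bigstar(s)\,G_s(u)\,ds\quad\text{for all }u>0,\ u\neq 1 . \] Let $V:(0,\infty)\to\mathbb{C}$ be an arbitrary function. If for every $c>0$ the function $u\mapsto V(u/c)$ has a $\bigstar$ transform, then $V(u)=0$ for all $u>0$. Consequently, the class of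 functions having a $\bigstar$ transform is not invariant under dilations: there are a function $V$ that has a $\bigstar$ transform and a number $c>0$ such that $u\mapsto V(u/c)$ has no $\bigstar$ transform. -/

import Mathlib

noncomputable section

/-- The kernel `G_s(u)` for the real parameter `μ`, meant for `u > 0`, `u ≠ 1`
(the value at `u = 1` is never used). Here `ordinaryHypergeometric a b c x` is the Gauss
hypergeometric function `F(a, b; c; x)`; its last argument `u ^ 2` or `u ^ (-2)` lies
in `(0, 1)`, where the defining series converges. -/
def starKernel (μ : ℝ) (s : ℂ) (u : ℝ) : ℂ :=
  if u < 1 then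
    (u : ℂ) ^ (2 * Complex.I * μ) *
      ordinaryHypergeometric (s / 2 + Complex.I * μ) (1 / 2 + Complex.I * μ) (s / 2 + 1 / 2)
        ((u : ℂ) ^ 2)
  else
    (u : ℂ) ^ (-s) *
      ordinaryHypergeometric (s / 2 + Complex.I * μ) (1 / 2 + Complex.I * μ) (s / 2 + 1 / 2)
        (((u : ℂ) ^ 2)⁻¹)

/-- The integral `∫_{(σ)} f(s) ds` along the upward line `s = σ + i t`, `ds = i dt`. -/
def verticalIntegral (σ : ℝ) (f : ℂ → ℂ) : ℂ :=
  ∫ t : ℝ, f (σ + t * Complex.I) * Complex.I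

/-- `Vstar`, of which only the values on the line `σ + iℝ` matter, is a star transform on this
line of the function `V` on the positive axis (values of `V` at `u ≤ 0` play no role):
`σ > 1`, for some `ε > 0` the function `|s| ^ (3/2 + ε) * Vstar s` is absolutely integrable
along the line, and `V u = (1 / 2πi) ∫_{(σ)} Vstar s * G_s(u) ds` for all `u > 0`, `u ≠ 1`. -/
structure IsStarTransform (μ : ℝ) (V : ℝ → ℂ) (σ : ℝ) (Vstar : ℂ → ℂ) : Prop where
  one_lt : 1 < σ
  integrable : ∃ ε : ℝ, 0 < ε ∧ MeasureTheory.Integrable (fun t : ℝ =>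
    ((‖(σ : ℂ) + t * Complex.I‖ ^ (3 / 2 + ε) : ℝ) : ℂ) * Vstar (σ + t * Complex.I))
  eq_integral : ∀ u : ℝ, 0 < u → u ≠ 1 →
    V u = (2 * Real.pi * Complex.I)⁻¹ *
      verticalIntegral σ (fun s => Vstar s * starKernel μ s u)

/-- `V` has a star transform, on some vertical line `σ + iℝ` with `σ > 1`. -/
def HasStarTransform (μ : ℝ) (V : ℝ → ℂ) : Prop :=
  ∃ (σ : ℝ) (Vstar : ℂ → ℂ), IsStarTransform μ V σ Vstar

end

/-! For `0 < u < 1` expand `F` in powers of `u ^ 2`. The dependence on `s` sits in the ratios `(s/2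
+ iμ)_n / (s/2 + 1/2)_n`, which are Beta integrals, hence moments of a density on `(0, 1]`.
Integrating against `Vstar` shows that `V u * u ^ (-2iμ)` is a power series in `u ^ 2` with
coefficients (up to the factor `2π`) `halfCoeff μ n * m_n`, where `m_n` is the `n`-th moment of one
integrable `g` (`IsStarTransform.exists_moment_expansion`). In particular `m_n` is bounded.

If `V (u / c)` has such an expansion too, with moments `m'_n`, then uniqueness of power series and
`halfCoeff μ n ≠ 0` give `|m_n| = |m'_n| c ^ (2n)`. As `c` is arbitrary, `m_n` decays faster than
any geometric sequence. No mass of `g` can then sit away from `0`, so all `m_n` vanish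
(`moments_eq_zero_of_moments_decay`) and `V = 0` on `(0, 1)`; one more dilation reaches every `u >
0`.

For the second claim it suffices to exhibit one nonzero function with a transform. -/

section StarTransform

open MeasureTheory Filter Topology Set

/-! ### Uniqueness of power series on a real interval. -/

/-- A power series that converges at some `r > 0` and whose sum vanishes on `(0, r)` is zero. -/
theorem eq_zero_of_hasSum_zero_on_Ioo {γ : ℕ → ℂ} {r : ℝ} (hr : 0 < r)
    (h : ∀ x : ℝ, 0 < x → x < r → HasSum (fun n => γ n * (x : ℂ) ^ n) 0) : γ = 0 := by
  by_contra hγ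
  set p := FormalMultilinearSeries.ofScalars ℂ γ with hp
  have hp0 : p ≠ 0 := by rwa [hp, Ne, FormalMultilinearSeries.ofScalars_series_eq_zero]
  have hrad : 0 < p.radius := by
    have h2 := (h (r / 2) (by positivity) (by linarith)).summable.norm
    have : ((r / 2).toNNReal : ENNReal) ≤ p.radius := by
      apply FormalMultilinearSeries.le_radius_of_summable
      refine h2.congr fun n => ?_
      rw [hp, FormalMultilinearSeries.ofScalars_norm, Real.coe_toNNReal _ (by positivity)]
      simp [abs_of_pos hr]
    refine lt_of_lt_of_le ?_ this
    simpa using hr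
  have hlnz := (p.hasFPowerSeriesOnBall hrad).hasFPowerSeriesAt.locally_ne_zero hp0
  have ht : Tendsto (fun x : ℝ => (x : ℂ)) (𝓝[>] 0) (𝓝[≠] 0) := by
    refine tendsto_nhdsWithin_iff.2 ⟨?_, ?_⟩
    · exact (Complex.continuous_ofReal.tendsto' 0 0 (by simp)).mono_left nhdsWithin_le_nhds
    · filter_upwards [self_mem_nhdsWithin] with x hx
      simpa using (ne_of_gt hx)
  obtain ⟨x, hx1, hx2⟩ := ((ht.eventually hlnz).and (Ioo_mem_nhdsGT hr)).exists
  apply hx1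
  rw [hp, FormalMultilinearSeries.sum]
  simp only [FormalMultilinearSeries.ofScalars_apply_eq, smul_eq_mul]
  exact (h x hx2.1 hx2.2).tsum_eq

theorem eq_of_hasSum_eq_on_Ioo {α β : ℕ → ℂ} {f : ℝ → ℂ} {r : ℝ} (hr : 0 < r)
    (hα : ∀ x : ℝ, 0 < x → x < r → HasSum (fun n => α n * (x : ℂ) ^ n) (f x))
    (hβ : ∀ x : ℝ, 0 < x → x < r → HasSum (fun n => β n * (x : ℂ) ^ n) (f x)) : α = β := by
  refine sub_eq_zero.1 (eq_zero_of_hasSum_zero_on_Ioo hr fun x h0 h1 => ?_)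
  simpa [sub_mul] using (hα x h0 h1).sub (hβ x h0 h1)

/-! ### Rapidly decaying moments on `(0, 1]`. -/

theorem integrable_pow_mul_Ioc {g : ℝ → ℂ} (hg : IntegrableOn g (Ioc 0 1)) (n : ℕ) :
    IntegrableOn (fun τ : ℝ => (τ : ℂ) ^ n * g τ) (Ioc 0 1) := by
  refine Integrable.mono hg (((by fun_prop : Continuous fun τ : ℝ =>
    (τ : ℂ) ^ n).aestronglyMeasurable).mul hg.aestronglyMeasurable) ?_
  filter_upwards [ae_restrict_mem measurableSet_Ioc] with τ hτ
  simp only [norm_mul, norm_pow, Complex.norm_real, Real.norm_eq_abs, abs_of_pos hτ.1]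
  exact mul_le_of_le_one_left (norm_nonneg _) (pow_le_one₀ hτ.1.le hτ.2)

/-- If all power moments of `g` on `(0, 1]` decay faster than any geometric sequence, then the
integral of `exp (-(y τ) ^ N) * g τ` tends to the integral of `g`. -/
theorem tendsto_integral_exp_neg_mul_pow {g : ℝ → ℂ} (hg : IntegrableOn g (Ioc 0 1))
    (hm : ∀ q : ℝ, 0 < q → ∃ K : ℝ, ∀ n : ℕ,
      ‖∫ τ in Ioc (0 : ℝ) 1, (τ : ℂ) ^ n * g τ‖ ≤ K * q ^ n) {y : ℝ} (hy : 0 < y) :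
    Tendsto (fun N : ℕ => ∫ τ in Ioc (0 : ℝ) 1, ((Real.exp (-(y * τ) ^ N) : ℝ) : ℂ) * g τ)
      atTop (𝓝 (∫ τ in Ioc (0 : ℝ) 1, g τ)) := by
  -- With this rate the `k`-th term of the exponential series is at most `K * (2 ^ (-N)) ^ k / k!`,
  -- so the terms with `k ≥ 1` sum to at most `K * (exp (2 ^ (-N)) - 1)`.
  obtain ⟨K, hK⟩ := hm (1 / (2 * y)) (by positivity)
  set m : ℕ → ℂ := fun n => ∫ τ in Ioc (0 : ℝ) 1, (τ : ℂ) ^ n * g τ with hmdef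
  have hsum (N : ℕ) : HasSum (fun k : ℕ => ((-y ^ N : ℝ) : ℂ) ^ k / (k.factorial : ℂ) * m (N * k))
      (∫ τ in Ioc (0 : ℝ) 1, ((Real.exp (-(y * τ) ^ N) : ℝ) : ℂ) * g τ) := by
    have h1 (k : ℕ) : Integrable (fun τ : ℝ => ((-y ^ N : ℝ) : ℂ) ^ k / (k.factorial : ℂ) *
        ((τ : ℂ) ^ (N * k) * g τ)) (volume.restrict (Ioc 0 1)) :=
      (integrable_pow_mul_Ioc hg (N * k)).const_mul _
    have h2 : Summable fun k : ℕ => ∫ τ in Ioc (0 : ℝ) 1, ‖((-y ^ N : ℝ) : ℂ) ^ k /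
        (k.factorial : ℂ) * ((τ : ℂ) ^ (N * k) * g τ)‖ := by
      refine Summable.of_nonneg_of_le (fun k => integral_nonneg fun _ => norm_nonneg _)
        (fun k => ?_) ((Real.summable_pow_div_factorial (y ^ N)).mul_right
          (∫ τ in Ioc (0 : ℝ) 1, ‖g τ‖))
      rw [← integral_const_mul]
      refine setIntegral_mono_on (h1 k).norm (hg.norm.const_mul _) measurableSet_Ioc fun τ hτ => ?_
      simp only [norm_mul, norm_div, norm_pow, Complex.norm_real, Real.norm_eq_abs,
        abs_of_pos hτ.1, abs_neg, abs_of_pos hy, Complex.norm_natCast, abs_pow]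
      gcongr
      exact mul_le_of_le_one_left (norm_nonneg _) (pow_le_one₀ hτ.1.le hτ.2)
    have h3 := hasSum_integral_of_summable_integral_norm h1 h2
    simp only [integral_const_mul] at h3
    refine Eq.subst (motive := fun z => HasSum _ z) ?_ h3
    refine integral_congr_ae (Eventually.of_forall fun τ => ?_)
    beta_reduce
    have h4 := (NormedSpace.expSeries_div_hasSum_exp (((-(y * τ) ^ N : ℝ)) : ℂ)).mul_right (g τ)
    rw [← Complex.exp_eq_exp_ℂ] at h4
    rw [Complex.ofReal_exp, ← h4.tsum_eq]
    refine tsum_congr fun k => ?_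
    push_cast
    rw [show -((y : ℂ) * τ) ^ N = -(y : ℂ) ^ N * (τ : ℂ) ^ N by ring, mul_pow, pow_mul]
    ring
  have hm0 : (∫ τ in Ioc (0 : ℝ) 1, g τ) = m 0 := by simp [hmdef]
  rw [hm0, tendsto_iff_norm_sub_tendsto_zero]
  have hbound (N : ℕ) : ‖(∫ τ in Ioc (0 : ℝ) 1, ((Real.exp (-(y * τ) ^ N) : ℝ) : ℂ) * g τ) - m 0‖
      ≤ K * (Real.exp ((1 / 2) ^ N) - 1) := by
    have h5 := (hasSum_nat_add_iff' 1).2 (hsum N)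
    have h6 := (hasSum_nat_add_iff' 1).2
      ((NormedSpace.expSeries_div_hasSum_exp (𝔸 := ℝ) ((1 / 2 : ℝ) ^ N)).mul_left K)
    rw [← Real.exp_eq_exp_ℝ] at h6
    simp only [Finset.range_one, Finset.sum_singleton, pow_zero, Nat.factorial_zero, Nat.cast_one,
      div_one, mul_one, one_mul, mul_zero] at h5 h6
    rw [mul_sub, mul_one]
    refine h5.norm_le_of_bounded h6 fun k => ?_
    rw [norm_mul, norm_div, norm_pow, Complex.norm_real, Real.norm_eq_abs, abs_neg,
      abs_of_pos (pow_pos hy N), Complex.norm_natCast]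
    calc (y ^ N) ^ (k + 1) / ((k + 1).factorial : ℝ) * ‖m (N * (k + 1))‖
        ≤ (y ^ N) ^ (k + 1) / ((k + 1).factorial : ℝ) * (K * (1 / (2 * y)) ^ (N * (k + 1))) := by
          gcongr
          exact hK _
      _ = K * (((1 / 2) ^ N) ^ (k + 1) / ((k + 1).factorial : ℝ)) := by
          rw [← pow_mul, ← pow_mul, show (1 / (2 * y)) = 1 / 2 * y⁻¹ by field_simp, mul_pow,
            inv_pow]
          field_simp
  refine squeeze_zero (fun _ => norm_nonneg _) hbound ?_
  have h7 : Tendsto (fun N : ℕ => ((1 / 2 : ℝ)) ^ N) atTop (𝓝 0) :=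
    tendsto_pow_atTop_nhds_zero_of_lt_one (by norm_num) (by norm_num)
  have h8 := ((Real.continuous_exp.tendsto 0).comp h7).sub_const 1 |>.const_mul K
  simpa using h8

/-- As `N → ∞`, `exp (-(y τ) ^ N)` tends to the indicator of `τ < 1 / y`. Dominated convergence thus
gives a second value for the limit, so `g` has the same integral over `(0, 1]` as over its part
below `1 / y`; then `y → ∞`. -/
theorem integral_eq_zero_of_moments_decay {g : ℝ → ℂ} (hg : IntegrableOn g (Ioc 0 1))
    (hm : ∀ q : ℝ, 0 < q → ∃ K : ℝ, ∀ n : ℕ,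
      ‖∫ τ in Ioc (0 : ℝ) 1, (τ : ℂ) ^ n * g τ‖ ≤ K * q ^ n) :
    ∫ τ in Ioc (0 : ℝ) 1, g τ = 0 := by
  have key (y : ℝ) (hy : 0 < y) : ∫ τ in Ioc (0 : ℝ) 1, g τ =
      ∫ τ in Ioc (0 : ℝ) 1, (Iio (1 / y)).indicator g τ := by
    refine tendsto_nhds_unique (tendsto_integral_exp_neg_mul_pow hg hm hy) ?_
    refine tendsto_integral_of_dominated_convergence (fun τ => ‖g τ‖) (fun N => ?_) hg.norm
      (fun N => ?_) ?_
    · exact ((by fun_prop : Continuous fun τ : ℝ =>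
        ((Real.exp (-(y * τ) ^ N) : ℝ) : ℂ)).aestronglyMeasurable).mul hg.aestronglyMeasurable
    · filter_upwards [ae_restrict_mem measurableSet_Ioc] with τ hτ
      rw [norm_mul, Complex.norm_real, Real.norm_eq_abs, Real.abs_exp]
      refine mul_le_of_le_one_left (norm_nonneg _) (Real.exp_le_one_iff.2 ?_)
      have := hτ.1
      simp only [Left.neg_nonpos_iff]; positivity
    -- At `τ = 1 / y` the integrand is constantly `exp (-1) * g τ`; this point is a null set.
    · have hne : ∀ᵐ τ : ℝ ∂(volume.restrict (Ioc 0 1)), τ ≠ 1 / y := by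
        refine ae_restrict_of_ae ?_
        simp [ae_iff]
      filter_upwards [ae_restrict_mem measurableSet_Ioc, hne] with τ hτ hτy
      have h0 : 0 ≤ y * τ := mul_nonneg hy.le hτ.1.le
      rcases lt_or_gt_of_ne hτy with h | h
      · rw [indicator_of_mem (by exact h)]
        have h1 : y * τ < 1 := by rw [lt_div_iff₀ hy] at h; linarith
        have h2 := tendsto_pow_atTop_nhds_zero_of_lt_one h0 h1
        have h3 : Tendsto (fun N : ℕ => ((Real.exp (-(y * τ) ^ N) : ℝ) : ℂ)) atTop (𝓝 1) := by
          have := (Complex.continuous_ofReal.tendsto _).comp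
            ((Real.continuous_exp.tendsto _).comp h2.neg)
          simpa [Function.comp_def] using this
        simpa using h3.mul_const (g τ)
      · rw [indicator_of_notMem (by simpa using h.le)]
        have h1 : 1 < y * τ := by
          have : 1 / y < τ := h
          rw [div_lt_iff₀ hy] at this; linarith
        have h2 := tendsto_pow_atTop_atTop_of_one_lt h1
        have h3 : Tendsto (fun N : ℕ => ((Real.exp (-(y * τ) ^ N) : ℝ) : ℂ)) atTop (𝓝 0) := by
          have := (Complex.continuous_ofReal.tendsto _).comp
            (Real.tendsto_exp_neg_atTop_nhds_zero.comp h2)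
          simpa [Function.comp_def] using this
        simpa using h3.mul_const (g τ)
  have hlim : Tendsto (fun n : ℕ => ∫ τ in Ioc (0 : ℝ) 1, (Iio (1 / ((n : ℝ) + 1))).indicator g τ)
      atTop (𝓝 (∫ τ in Ioc (0 : ℝ) 1, (0 : ℂ))) := by
    refine tendsto_integral_of_dominated_convergence (fun τ => ‖g τ‖) (fun N => ?_) hg.norm
      (fun N => ?_) ?_
    · exact hg.aestronglyMeasurable.indicator measurableSet_Iio
    · exact Eventually.of_forall fun τ => norm_indicator_le_norm_self _ _
    · filter_upwards [ae_restrict_mem measurableSet_Ioc] with τ hτ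
      refine tendsto_const_nhds.congr' ?_
      filter_upwards [(tendsto_one_div_add_atTop_nhds_zero_nat (𝕜 := ℝ)).eventually_lt_const hτ.1]
        with n hn
      rw [indicator_of_notMem (by simpa using hn.le)]
  simp only [integral_zero] at hlim
  refine tendsto_nhds_unique (tendsto_const_nhds.congr fun n => ?_) hlim
  exact key _ (by positivity)

/-- Power moments on `(0, 1]` that decay faster than any geometric sequence all vanish. -/
theorem moments_eq_zero_of_moments_decay {g : ℝ → ℂ} (hg : IntegrableOn g (Ioc 0 1))
    (hm : ∀ q : ℝ, 0 < q → ∃ K : ℝ, ∀ n : ℕ,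
      ‖∫ τ in Ioc (0 : ℝ) 1, (τ : ℂ) ^ n * g τ‖ ≤ K * q ^ n) (j : ℕ) :
    ∫ τ in Ioc (0 : ℝ) 1, (τ : ℂ) ^ j * g τ = 0 := by
  refine integral_eq_zero_of_moments_decay (integrable_pow_mul_Ioc hg j) fun q hq => ?_
  obtain ⟨K, hK⟩ := hm q hq
  refine ⟨K * q ^ j, fun n => ?_⟩
  simp only [← mul_assoc, ← pow_add]
  refine (hK (n + j)).trans_eq ?_
  ring

/-! ### Beta integrals and growth of the weight. -/

/-- The constant relating `(s / 2 + iμ)_n / (s / 2 + 1 / 2)_n` to a Beta integral. -/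
noncomputable def starWeight (μ : ℝ) (s : ℂ) : ℂ :=
  Complex.Gamma (s / 2 + 1 / 2) * (Complex.Gamma (s / 2 + Complex.I * μ))⁻¹ *
    (Complex.Gamma (1 / 2 - Complex.I * μ))⁻¹

/-- The coefficients `(1 / 2 + iμ)_n / n!`. -/
noncomputable def halfCoeff (μ : ℝ) (n : ℕ) : ℂ :=
  ((n.factorial : ℂ))⁻¹ * (ascPochhammer ℂ n).eval (1 / 2 + Complex.I * μ)

/-- The ratio `(s / 2 + iμ)_n / (s / 2 + 1 / 2)_n`. -/
noncomputable def pochhammerRatio (μ : ℝ) (n : ℕ) (s : ℂ) : ℂ :=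
  (ascPochhammer ℂ n).eval (s / 2 + Complex.I * μ) *
    ((ascPochhammer ℂ n).eval (s / 2 + 1 / 2))⁻¹

theorem Complex.ne_neg_natCast_of_re_pos {z : ℂ} (hz : 0 < z.re) (k : ℕ) : z ≠ -k := by
  rintro rfl
  simp only [Complex.neg_re, Complex.natCast_re, Left.neg_pos_iff] at hz
  exact absurd hz (not_lt.2 (Nat.cast_nonneg k))

theorem pochhammerRatio_eq_betaIntegral (μ : ℝ) (n : ℕ) {s : ℂ} (hs : 0 < s.re) :
    pochhammerRatio μ n s = starWeight μ s *
      Complex.betaIntegral (s / 2 + Complex.I * μ + n) (1 / 2 - Complex.I * μ) := by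
  have ha : 0 < (s / 2 + Complex.I * μ).re := by simp [hs]
  have hc : 0 < (s / 2 + 1 / 2).re := by simp; linarith
  have hv : 0 < (1 / 2 - Complex.I * (μ : ℂ)).re := by simp
  have han : 0 < (s / 2 + Complex.I * μ + n).re := by
    rw [Complex.add_re, Complex.natCast_re]; positivity
  rw [pochhammerRatio, starWeight, Complex.betaIntegral_eq_Gamma_mul_div _ _ han hv,
    ← Complex.Gamma_add_nat_div_Gamma_eq _ (Complex.ne_neg_natCast_of_re_pos ha),
    ← Complex.Gamma_add_nat_div_Gamma_eq _ (Complex.ne_neg_natCast_of_re_pos hc),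
    show s / 2 + Complex.I * μ + n + (1 / 2 - Complex.I * μ) = s / 2 + 1 / 2 + n by ring, inv_div]
  have := Complex.Gamma_ne_zero_of_re_pos hv
  generalize Complex.Gamma (1 / 2 - Complex.I * μ) = B at *
  generalize Complex.Gamma (s / 2 + Complex.I * μ) = A
  generalize Complex.Gamma (s / 2 + 1 / 2) = C
  field_simp

theorem Complex.norm_betaIntegral_le {u v : ℂ} (hu : u.re ≠ 1) (hv : v.re ≠ 1) :
    ‖Complex.betaIntegral u v‖ ≤
      ∫ τ in Ioc (0 : ℝ) 1, τ ^ (u.re - 1) * (1 - τ) ^ (v.re - 1) := by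
  rw [Complex.betaIntegral, intervalIntegral.integral_of_le zero_le_one]
  refine (norm_integral_le_integral_norm _).trans_eq (setIntegral_congr_fun measurableSet_Ioc
    fun τ hτ => ?_)
  have h1 : (1 - (τ : ℂ)) = ((1 - τ : ℝ) : ℂ) := by push_cast; ring
  simp only [norm_mul]
  -- At base `0` the norm formula fails for a nonzero imaginary exponent, so exponents of real part
  -- `0` are excluded.
  rw [h1, Complex.norm_cpow_eq_rpow_re_of_nonneg hτ.1.le (by simpa [sub_eq_zero] using hu),
    Complex.norm_cpow_eq_rpow_re_of_nonneg (by linarith [hτ.2]) (by simpa [sub_eq_zero] using hv)]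
  simp

/-- Trades the Gamma quotient for a Beta integral bounded on vertical lines, which yields linear
growth in `s` without Stirling's formula. -/
theorem starWeight_eq_betaIntegral (μ : ℝ) {s : ℂ} (hs : 0 < s.re) :
    starWeight μ s = (s / 2 + Complex.I * μ) *
      Complex.betaIntegral (s / 2 + 1 / 2) (1 / 2 + Complex.I * μ) *
      ((Complex.Gamma (1 / 2 + Complex.I * μ))⁻¹ * (Complex.Gamma (1 / 2 - Complex.I * μ))⁻¹) := by
  have ha : 0 < (s / 2 + Complex.I * μ).re := by simp [hs]
  have hc : 0 < (s / 2 + 1 / 2).re := by simp; linarith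
  have hv : 0 < (1 / 2 + Complex.I * (μ : ℂ)).re := by simp
  have ha0 : s / 2 + Complex.I * μ ≠ 0 := fun h => by rw [h] at ha; simp at ha
  rw [starWeight, Complex.betaIntegral_eq_Gamma_mul_div _ _ hc hv,
    show s / 2 + 1 / 2 + (1 / 2 + Complex.I * μ) = s / 2 + Complex.I * μ + 1 by ring,
    Complex.Gamma_add_one _ ha0]
  have := Complex.Gamma_ne_zero_of_re_pos hv
  have := Complex.Gamma_ne_zero_of_re_pos ha
  generalize Complex.Gamma (1 / 2 + Complex.I * μ) = B at *
  generalize Complex.Gamma (s / 2 + Complex.I * μ) = A at *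
  generalize s / 2 + Complex.I * μ = a at *
  field_simp

theorem exists_norm_starWeight_le (μ : ℝ) {σ : ℝ} (hσ : 1 < σ) :
    ∃ K : ℝ, ∀ s : ℂ, s.re = σ → ‖starWeight μ s‖ ≤ K * ‖s‖ := by
  set C := ∫ τ in Ioc (0 : ℝ) 1, τ ^ (σ / 2 + 1 / 2 - 1) * (1 - τ) ^ ((1 : ℝ) / 2 - 1) with hC
  set D := ‖(Complex.Gamma (1 / 2 + Complex.I * μ))⁻¹ *
    (Complex.Gamma (1 / 2 - Complex.I * μ))⁻¹‖
  refine ⟨(1 / 2 + |μ| / σ) * C * D, fun s hs => ?_⟩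
  have hB : ‖Complex.betaIntegral (s / 2 + 1 / 2) (1 / 2 + Complex.I * μ)‖ ≤ C := by
    have h1 : (s / 2 + 1 / 2).re = σ / 2 + 1 / 2 := by simp [hs]
    have h2 : (1 / 2 + Complex.I * (μ : ℂ)).re = 1 / 2 := by simp
    have := Complex.norm_betaIntegral_le (u := s / 2 + 1 / 2) (v := 1 / 2 + Complex.I * μ)
      (by rw [h1]; linarith) (by rw [h2]; norm_num)
    rwa [h1, h2] at this
  have hsσ : σ ≤ ‖s‖ := hs ▸ Complex.re_le_norm s
  have hA : ‖s / 2 + Complex.I * μ‖ ≤ (1 / 2 + |μ| / σ) * ‖s‖ := by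
    refine (norm_add_le _ _).trans ?_
    have : |μ| ≤ |μ| / σ * ‖s‖ := by
      rw [div_mul_eq_mul_div, le_div_iff₀ (by linarith)]
      gcongr
    simp only [norm_div, norm_mul, Complex.norm_I, Complex.norm_real, Real.norm_eq_abs, one_mul,
      Complex.norm_ofNat]
    linarith
  rw [starWeight_eq_betaIntegral μ (by rw [hs]; linarith), norm_mul, norm_mul]
  calc _ ≤ (1 / 2 + |μ| / σ) * ‖s‖ * C * D := by
        gcongr
    _ = _ := by ring

theorem continuous_starWeight_line (μ : ℝ) {σ : ℝ} (hσ : 0 < σ) :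
    Continuous fun t : ℝ => starWeight μ (σ + t * Complex.I) := by
  unfold starWeight
  refine (Continuous.mul ?_ ?_).mul continuous_const
  · refine continuous_iff_continuousAt.2 fun t => ?_
    have h := (Complex.differentiableAt_Gamma (((σ : ℂ) + t * Complex.I) / 2 + 1 / 2)
      (Complex.ne_neg_natCast_of_re_pos (by simp; linarith))).continuousAt
    exact ContinuousAt.comp (f := fun t : ℝ => ((σ : ℂ) + t * Complex.I) / 2 + 1 / 2) h
      (by fun_prop)
  · exact Complex.differentiable_one_div_Gamma.continuous.comp (by fun_prop)

theorem summable_norm_halfCoeff_mul_pow (μ : ℝ) {r : ℝ} (h0 : 0 ≤ r) (h1 : r < 1) :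
    Summable fun n => ‖halfCoeff μ n‖ * r ^ n := by
  -- `F(1/2 + iμ, 1; 1; x)` has exactly the coefficients `halfCoeff μ n`.
  have hrad := ordinaryHypergeometricSeries_radius_eq_one ℂ (1 / 2 + Complex.I * μ) 1 1
    (fun k => by
      have h2 := Complex.ne_neg_natCast_of_re_pos (z := 1 / 2 + Complex.I * (μ : ℂ)) (by simp) k
      have h3 := Complex.ne_neg_natCast_of_re_pos (z := 1) (by simp) k
      refine ⟨fun h => h2 (by rw [h, neg_neg]), fun h => h3 (by rw [h, neg_neg]),
        fun h => h3 (by rw [h, neg_neg])⟩)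
  have hr : (r.toNNReal : ENNReal) <
      (ordinaryHypergeometricSeries ℂ (1 / 2 + Complex.I * (μ : ℂ)) 1 1).radius := by
    rw [hrad]; simpa using h1
  have h := FormalMultilinearSeries.summable_norm_mul_pow _ hr
  refine h.congr fun n => ?_
  have h4 : (ascPochhammer ℂ n).eval 1 ≠ 0 := by
    rw [ascPochhammer_eval_one]; exact_mod_cast n.factorial_ne_zero
  rw [ordinaryHypergeometricSeries, FormalMultilinearSeries.ofScalars_norm,
    Real.coe_toNNReal _ h0, halfCoeff, ordinaryHypergeometricCoefficient,
    mul_inv_cancel_right₀ h4]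

theorem halfCoeff_ne_zero (μ : ℝ) (n : ℕ) : halfCoeff μ n ≠ 0 := by
  refine mul_ne_zero (by simp [n.factorial_ne_zero]) ?_
  rw [Ne, ascPochhammer_eval_eq_zero_iff]
  rintro ⟨k, -, h⟩
  exact Complex.ne_neg_natCast_of_re_pos (z := 1 / 2 + Complex.I * (μ : ℂ)) (by simp) k
    (by rw [h, neg_neg])

theorem ordinaryHypergeometric_eq_tsum_halfCoeff (μ : ℝ) (s x : ℂ) :
    ordinaryHypergeometric (s / 2 + Complex.I * μ) (1 / 2 + Complex.I * μ) (s / 2 + 1 / 2) x =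
      ∑' n, halfCoeff μ n * x ^ n * pochhammerRatio μ n s := by
  rw [ordinaryHypergeometric_eq_tsum]
  refine tsum_congr fun n => ?_
  rw [halfCoeff, pochhammerRatio, smul_eq_mul]
  ring

/-! ### Expansion with moment coefficients. -/

/-- The Beta density `τ ^ (s / 2 + iμ - 1) (1 - τ) ^ (1 / 2 - iμ - 1)`. -/
noncomputable def betaDensity (μ : ℝ) (s : ℂ) (τ : ℝ) : ℂ :=
  (τ : ℂ) ^ (s / 2 + Complex.I * μ - 1) * (1 - (τ : ℂ)) ^ (1 / 2 - Complex.I * (μ : ℂ) - 1)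

theorem integral_pow_mul_betaDensity (μ : ℝ) (n : ℕ) (s : ℂ) :
    ∫ τ in Ioc (0 : ℝ) 1, (τ : ℂ) ^ n * betaDensity μ s τ =
      Complex.betaIntegral (s / 2 + Complex.I * μ + n) (1 / 2 - Complex.I * μ) := by
  rw [Complex.betaIntegral, intervalIntegral.integral_of_le zero_le_one]
  refine setIntegral_congr_fun measurableSet_Ioc fun τ hτ => ?_
  have h : (τ : ℂ) ≠ 0 := by exact_mod_cast hτ.1.ne'
  simp only [betaDensity]
  rw [show s / 2 + Complex.I * μ + n - 1 = (n : ℂ) + (s / 2 + Complex.I * μ - 1) by ring,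
    Complex.cpow_add _ _ h, Complex.cpow_natCast, mul_assoc]

/-- The norm depends on `s` only through `s.re`, so along a vertical line one integrable function of
`τ` dominates and Fubini applies. -/
theorem norm_betaDensity_eq (μ : ℝ) (s : ℂ) {τ : ℝ} (hτ : τ ∈ Ioc (0 : ℝ) 1) :
    ‖betaDensity μ s τ‖ = τ ^ (s.re / 2 - 1) * (1 - τ) ^ (-(1 / 2) : ℝ) := by
  have h1 : (1 - (τ : ℂ)) = ((1 - τ : ℝ) : ℂ) := by push_cast; ring
  have h2 : (1 / 2 - Complex.I * (μ : ℂ) - 1).re = -(1 / 2) := by simp; norm_num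
  rw [betaDensity, norm_mul, h1, Complex.norm_cpow_eq_rpow_re_of_pos hτ.1,
    Complex.norm_cpow_eq_rpow_re_of_nonneg (by linarith [hτ.2]) (by rw [h2]; norm_num), h2]
  simp

theorem integrableOn_rpow_mul_one_sub_rpow {σ : ℝ} (hσ : 0 < σ) :
    IntegrableOn (fun τ : ℝ => τ ^ (σ / 2 - 1) * (1 - τ) ^ (-(1 / 2) : ℝ)) (Ioc 0 1) := by
  have h := Complex.betaIntegral_convergent (u := (σ : ℂ) / 2) (v := 1 / 2)
    (by simpa using hσ) (by simp)
  rw [intervalIntegrable_iff_integrableOn_Ioc_of_le zero_le_one] at h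
  refine h.norm.congr ?_
  filter_upwards [ae_restrict_mem measurableSet_Ioc] with τ hτ
  have := norm_betaDensity_eq 0 σ hτ
  simpa [betaDensity] using this

theorem integrable_prod_mul_betaDensity (μ : ℝ) {σ : ℝ} (hσ : 0 < σ) {H : ℝ → ℂ}
    (hH : Integrable H) (n : ℕ) :
    Integrable (fun p : ℝ × ℝ => (p.1 : ℂ) ^ n * (H p.2 * betaDensity μ (σ + p.2 * Complex.I) p.1))
      ((volume.restrict (Ioc 0 1)).prod volume) := by
  have hd := (integrableOn_rpow_mul_one_sub_rpow hσ).mul_prod hH.norm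
  refine hd.mono (AEStronglyMeasurable.mul ?_ (AEStronglyMeasurable.mul ?_ ?_)) ?_
  · exact (by fun_prop : Measurable fun p : ℝ × ℝ => (p.1 : ℂ) ^ n).aestronglyMeasurable
  · exact hH.aestronglyMeasurable.comp_snd
  · refine Measurable.aestronglyMeasurable ?_
    unfold betaDensity
    fun_prop
  · have hmem : ∀ᵐ p : ℝ × ℝ ∂((volume.restrict (Ioc 0 1)).prod volume), p.1 ∈ Ioc (0 : ℝ) 1 :=
      Measure.quasiMeasurePreserving_fst.ae (ae_restrict_mem measurableSet_Ioc)
    filter_upwards [hmem] with p hp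
    rw [norm_mul, norm_mul, norm_betaDensity_eq μ _ hp, norm_mul, norm_norm, norm_pow,
      Complex.norm_real, Real.norm_eq_abs, abs_of_pos hp.1]
    have h1 : 0 ≤ p.1 ^ (σ / 2 - 1) * (1 - p.1) ^ (-(1 / 2) : ℝ) :=
      mul_nonneg (Real.rpow_nonneg hp.1.le _) (Real.rpow_nonneg (by linarith [hp.2]) _)
    rw [Real.norm_of_nonneg h1]
    have h2 : ((σ : ℂ) + p.2 * Complex.I).re = σ := by simp
    rw [h2, mul_comm (‖H p.2‖)]
    exact mul_le_of_le_one_left (by positivity) (pow_le_one₀ hp.1.le hp.2)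

/-- The integral of `w` against the hypergeometric kernel along `σ + iℝ` is a power series in `z`
whose coefficients are `halfCoeff μ n` times the moments of an integrable function. -/
theorem exists_moment_expansion (μ : ℝ) {σ : ℝ} (hσ : 1 < σ) {w : ℝ → ℂ}
    (hw : AEStronglyMeasurable w)
    (hw' : Integrable fun t : ℝ => ‖(σ : ℂ) + t * Complex.I‖ * ‖w t‖) :
    ∃ g : ℝ → ℂ, IntegrableOn g (Ioc 0 1) ∧ ∫ τ in Ioc (0 : ℝ) 1, g τ = ∫ t, w t ∧
      ∀ z : ℂ, ‖z‖ < 1 →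
        HasSum (fun n : ℕ => halfCoeff μ n * (∫ τ in Ioc (0 : ℝ) 1, (τ : ℂ) ^ n * g τ) * z ^ n)
          (∫ t : ℝ, w t * ordinaryHypergeometric (((σ : ℂ) + t * Complex.I) / 2 + Complex.I * μ)
            (1 / 2 + Complex.I * μ) (((σ : ℂ) + t * Complex.I) / 2 + 1 / 2) z) := by
  have hσ0 : 0 < σ := by linarith
  obtain ⟨K, hK⟩ := exists_norm_starWeight_le μ hσ
  set H : ℝ → ℂ := fun t => w t * starWeight μ (σ + t * Complex.I) with hHdef
  have hH : Integrable H := by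
    refine (hw'.const_mul K).mono (hw.mul
      (continuous_starWeight_line μ hσ0).aestronglyMeasurable) (Eventually.of_forall fun t => ?_)
    rw [hHdef, norm_mul]
    refine le_trans ?_ (le_abs_self _)
    rw [← mul_assoc, mul_comm]
    gcongr
    exact hK _ (by simp)
  set F : ℕ → ℝ × ℝ → ℂ := fun n p =>
    (p.1 : ℂ) ^ n * (H p.2 * betaDensity μ (σ + p.2 * Complex.I) p.1) with hF
  have hFint (n : ℕ) : Integrable (F n) ((volume.restrict (Ioc 0 1)).prod volume) :=
    integrable_prod_mul_betaDensity μ hσ0 hH n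
  have hinner (n : ℕ) (t : ℝ) : ∫ τ in Ioc (0 : ℝ) 1, F n (τ, t) =
      w t * pochhammerRatio μ n (σ + t * Complex.I) := by
    rw [pochhammerRatio_eq_betaIntegral μ n (by simpa using hσ0), ← integral_pow_mul_betaDensity,
      ← mul_assoc, ← integral_const_mul]
    refine integral_congr_ae (Eventually.of_forall fun τ => ?_)
    simp only [hF, hHdef]
    ring
  set g : ℝ → ℂ := fun τ => ∫ t : ℝ, H t * betaDensity μ (σ + t * Complex.I) τ with hg
  have hgint : IntegrableOn g (Ioc 0 1) := by
    have := (hFint 0).integral_prod_left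
    simpa [hF, hg, IntegrableOn] using this
  have hmom (n : ℕ) : ∫ τ in Ioc (0 : ℝ) 1, (τ : ℂ) ^ n * g τ =
      ∫ t, w t * pochhammerRatio μ n (σ + t * Complex.I) := by
    simp_rw [← hinner n]
    rw [integral_integral_swap (f := fun t τ => F n (τ, t)) (hFint n).swap]
    refine integral_congr_ae (Eventually.of_forall fun τ => ?_)
    simp only [hF, hg]
    rw [← integral_const_mul]
  refine ⟨g, hgint, ?_, fun z hz => ?_⟩
  · simpa [pochhammerRatio] using hmom 0
  · have hint (n : ℕ) : Integrable fun t : ℝ => halfCoeff μ n * z ^ n *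
        (w t * pochhammerRatio μ n (σ + t * Complex.I)) := by
      have := (hFint n).integral_prod_right
      simp only [hinner] at this
      exact this.const_mul _
    have hsum : Summable fun n => ∫ t : ℝ, ‖halfCoeff μ n * z ^ n *
        (w t * pochhammerRatio μ n (σ + t * Complex.I))‖ := by
      refine Summable.of_nonneg_of_le (fun n => integral_nonneg fun _ => norm_nonneg _)
        (fun n => ?_) ((summable_norm_halfCoeff_mul_pow μ (norm_nonneg z) hz).mul_right
          -- Since `τ ^ n ≤ 1`, the case `n = 0` dominates every `F n`.
          (∫ t : ℝ, ∫ τ in Ioc (0 : ℝ) 1, ‖F 0 (τ, t)‖))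
      rw [← integral_const_mul]
      refine integral_mono_ae (hint n).norm ((hFint 0).norm.integral_prod_right.const_mul _) ?_
      filter_upwards [(hFint 0).prod_left_ae] with t ht
      rw [norm_mul, norm_mul, norm_pow, ← hinner]
      gcongr
      refine (norm_integral_le_integral_norm _).trans ?_
      refine integral_mono_of_nonneg (Eventually.of_forall fun _ => norm_nonneg _) ht.norm ?_
      filter_upwards [ae_restrict_mem measurableSet_Ioc] with τ hτ
      simp only [hF, norm_mul, norm_pow, Complex.norm_real, Real.norm_eq_abs, abs_of_pos hτ.1,
        pow_zero, one_mul]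
      exact mul_le_of_le_one_left (by positivity) (pow_le_one₀ hτ.1.le hτ.2)
    have h := hasSum_integral_of_summable_integral_norm hint hsum
    simp only [integral_const_mul, ← hmom] at h
    refine Eq.subst (motive := fun x => HasSum _ x) ?_ (h.congr_fun ?_)
    · refine integral_congr_ae (Eventually.of_forall fun t => ?_)
      beta_reduce
      rw [ordinaryHypergeometric_eq_tsum_halfCoeff, ← tsum_mul_left]
      exact tsum_congr fun n => by ring
    · intro n
      ring

theorem IsStarTransform.exists_moment_expansion {μ : ℝ} {V : ℝ → ℂ} {σ : ℝ} {Vstar : ℂ → ℂ}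
    (h : IsStarTransform μ V σ Vstar) :
    ∃ g : ℝ → ℂ, IntegrableOn g (Ioc 0 1) ∧
      ∫ τ in Ioc (0 : ℝ) 1, g τ = ∫ t : ℝ, Vstar (σ + t * Complex.I) ∧
      ∀ u : ℝ, 0 < u → u < 1 →
        HasSum (fun n : ℕ => halfCoeff μ n * (∫ τ in Ioc (0 : ℝ) 1, (τ : ℂ) ^ n * g τ) *
          ((u : ℂ) ^ 2) ^ n) (2 * Real.pi * V u * (u : ℂ) ^ (-(2 * Complex.I * μ))) := by
  obtain ⟨ε, hε, hint⟩ := h.integrable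
  have hσ := h.one_lt
  have hs (t : ℝ) : 1 < ‖(σ : ℂ) + t * Complex.I‖ := by
    refine hσ.trans_le ?_
    simpa using Complex.re_le_norm ((σ : ℂ) + t * Complex.I)
  -- Measurability of `Vstar` on the line is recovered by dividing out the nonvanishing weight.
  have hw : AEStronglyMeasurable fun t : ℝ => Vstar (σ + t * Complex.I) := by
    have hm : Measurable fun t : ℝ =>
        (((‖(σ : ℂ) + t * Complex.I‖ ^ (3 / 2 + ε) : ℝ) : ℂ))⁻¹ := by fun_prop
    refine (hm.aestronglyMeasurable.mul hint.aestronglyMeasurable).congr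
      (Eventually.of_forall fun t => ?_)
    have h0 : ((‖(σ : ℂ) + t * Complex.I‖ ^ (3 / 2 + ε) : ℝ) : ℂ) ≠ 0 := by
      exact_mod_cast (Real.rpow_pos_of_pos (by linarith [hs t]) _).ne'
    simp only [Pi.mul_apply]
    rw [inv_mul_cancel_left₀ h0]
  have hw' : Integrable fun t : ℝ =>
      ‖(σ : ℂ) + t * Complex.I‖ * ‖Vstar (σ + t * Complex.I)‖ := by
    refine hint.norm.mono ((by fun_prop : Continuous fun t : ℝ =>
      ‖(σ : ℂ) + t * Complex.I‖).aestronglyMeasurable.mul hw.norm) (Eventually.of_forall fun t => ?_)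
    simp only [norm_mul, norm_norm, Complex.norm_real]
    gcongr
    rw [Real.norm_of_nonneg (by positivity)]
    exact Real.self_le_rpow_of_one_le (hs t).le (by linarith)
  obtain ⟨g, hg, hg0, hsum⟩ := _root_.exists_moment_expansion μ hσ hw hw'
  refine ⟨g, hg, hg0, fun u hu0 hu1 => ?_⟩
  have hz : ‖(u : ℂ) ^ 2‖ < 1 := by
    rw [norm_pow, Complex.norm_real, Real.norm_of_nonneg hu0.le]
    exact pow_lt_one₀ hu0.le hu1 two_ne_zero
  refine Eq.subst (motive := fun x => HasSum _ x) ?_ (hsum _ hz)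
  have hu : (u : ℂ) ≠ 0 := by exact_mod_cast hu0.ne'
  have hup : (u : ℂ) ^ (2 * Complex.I * (μ : ℂ)) ≠ 0 := by simp [Complex.cpow_eq_zero_iff, hu]
  have hpi : (Real.pi : ℂ) ≠ 0 := by exact_mod_cast Real.pi_ne_zero
  rw [h.eq_integral u hu0 hu1.ne, verticalIntegral, integral_mul_const, Complex.cpow_neg]
  simp only [starKernel, if_pos hu1, mul_left_comm _ ((u : ℂ) ^ (2 * Complex.I * (μ : ℂ)))]
  rw [integral_const_mul]
  generalize (u : ℂ) ^ (2 * Complex.I * (μ : ℂ)) = P at *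
  have hI := Complex.I_ne_zero
  generalize (∫ t : ℝ, _ : ℂ) = J
  field_simp

/-! ### Comparison of a function with its dilates. -/

theorem norm_moment_le {g : ℝ → ℂ} (hg : IntegrableOn g (Ioc 0 1)) (n : ℕ) :
    ‖∫ τ in Ioc (0 : ℝ) 1, (τ : ℂ) ^ n * g τ‖ ≤ ∫ τ in Ioc (0 : ℝ) 1, ‖g τ‖ := by
  refine (norm_integral_le_integral_norm _).trans (setIntegral_mono_on
    (integrable_pow_mul_Ioc hg n).norm hg.norm measurableSet_Ioc fun τ hτ => ?_)
  rw [norm_mul, norm_pow, Complex.norm_real, Real.norm_eq_abs, abs_of_pos hτ.1]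
  exact mul_le_of_le_one_left (norm_nonneg _) (pow_le_one₀ hτ.1.le hτ.2)

theorem eq_zero_on_Ioo_of_forall_dilate_hasStarTransform {μ : ℝ} {V : ℝ → ℂ}
    (hV : ∀ c : ℝ, 0 < c → HasStarTransform μ fun u => V (u / c)) {u : ℝ} (hu0 : 0 < u)
    (hu1 : u < 1) : V u = 0 := by
  obtain ⟨σ, Vstar, h⟩ := hV 1 one_pos
  obtain ⟨g, hg, -, hsum⟩ := h.exists_moment_expansion
  simp only [div_one] at hsum
  have hdecay (q : ℝ) (hq : 0 < q) : ∃ K : ℝ, ∀ n : ℕ,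
      ‖∫ τ in Ioc (0 : ℝ) 1, (τ : ℂ) ^ n * g τ‖ ≤ K * q ^ n := by
    -- The series variable is `u ^ 2`, so dilating by `c` scales the `n`-th coefficient by `c ^ (2n)
    -- = q ^ n`.
    set c := √q with hc
    have hc0 : 0 < c := Real.sqrt_pos.2 hq
    have hcq : c ^ 2 = q := Real.sq_sqrt hq.le
    obtain ⟨σ', Vstar', h'⟩ := hV c hc0
    obtain ⟨g', hg', -, hsum'⟩ := h'.exists_moment_expansion
    refine ⟨∫ τ in Ioc (0 : ℝ) 1, ‖g' τ‖, fun n => ?_⟩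
    set P : ℂ := (c : ℂ) ^ (-(2 * Complex.I * (μ : ℂ))) with hP
    have hPn : ‖P‖ = 1 := by
      rw [hP, Complex.norm_cpow_eq_rpow_re_of_pos hc0]
      simp
    -- On this range both `√x` and `c * √x` lie in `(0, 1)`.
    have hr : 0 < min 1 (1 / q) := by positivity
    have hcoeff := eq_of_hasSum_eq_on_Ioo hr
      (α := fun n => P * (halfCoeff μ n * ∫ τ in Ioc (0 : ℝ) 1, (τ : ℂ) ^ n * g τ))
      (β := fun n => halfCoeff μ n * (∫ τ in Ioc (0 : ℝ) 1, (τ : ℂ) ^ n * g' τ) * (q : ℂ) ^ n)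
      (f := fun x => P * (2 * Real.pi * V √x * (√x : ℂ) ^ (-(2 * Complex.I * (μ : ℂ)))))
      (fun x hx0 hx1 => by
        have hx : (√x : ℂ) ^ 2 = x := by exact_mod_cast Real.sq_sqrt hx0.le
        have h1 := (hsum √x (Real.sqrt_pos.2 hx0)
          ((Real.sqrt_lt' one_pos).2 (by simpa using hx1.trans_le (min_le_left _ _)))).mul_left P
        rw [hx] at h1
        simpa only [mul_assoc] using h1)
      (fun x hx0 hx1 => by
        have hx : ((c * √x : ℝ) : ℂ) ^ 2 = q * x := by
          rw [← hcq]
          exact_mod_cast (by rw [mul_pow, Real.sq_sqrt hx0.le] : (c * √x) ^ 2 = c ^ 2 * x)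
        have hx2 : c * √x < 1 := by
          have hqx : q * x < 1 := by
            have := hx1.trans_le (min_le_right _ _)
            rw [lt_div_iff₀ hq] at this
            linarith
          rw [hc, ← Real.sqrt_mul hq.le]
          exact (Real.sqrt_lt' one_pos).2 (by simpa using hqx)
        have h1 := hsum' (c * √x) (mul_pos hc0 (Real.sqrt_pos.2 hx0)) hx2
        rw [hx, mul_div_cancel_left₀ _ hc0.ne', Complex.ofReal_mul,
          Complex.mul_cpow_ofReal_nonneg hc0.le (Real.sqrt_nonneg x), ← hP] at h1
        simp only [mul_pow, ← mul_assoc] at h1 ⊢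
        convert h1 using 1
        ring)
    have h2 : P * ∫ τ in Ioc (0 : ℝ) 1, (τ : ℂ) ^ n * g τ =
        (∫ τ in Ioc (0 : ℝ) 1, (τ : ℂ) ^ n * g' τ) * (q : ℂ) ^ n := by
      refine mul_left_cancel₀ (halfCoeff_ne_zero μ n) ?_
      have := congrFun hcoeff n
      linear_combination this
    have h3 := congrArg norm h2
    rw [norm_mul, hPn, one_mul, norm_mul, norm_pow, Complex.norm_real,
      Real.norm_of_nonneg hq.le] at h3
    rw [h3]
    gcongr
    exact norm_moment_le hg' n
  have h4 := hsum u hu0 hu1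
  simp only [moments_eq_zero_of_moments_decay hg hdecay, mul_zero, zero_mul] at h4
  have h5 := h4.unique hasSum_zero
  have hu : (u : ℂ) ≠ 0 := by exact_mod_cast hu0.ne'
  simpa [Complex.cpow_eq_zero_iff, hu, Real.pi_ne_zero] using h5

theorem eq_zero_of_forall_dilate_hasStarTransform {μ : ℝ} {V : ℝ → ℂ}
    (hV : ∀ c : ℝ, 0 < c → HasStarTransform μ fun u => V (u / c)) {u : ℝ} (hu : 0 < u) :
    V u = 0 := by
  -- This dilation moves the point `u` to `1 / 2`.
  have hc : 0 < 1 / (2 * u) := by positivity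
  have h := eq_zero_on_Ioo_of_forall_dilate_hasStarTransform (μ := μ)
    (V := fun v => V (v / (1 / (2 * u))))
    (fun c hc' => by
      have := hV (c * (1 / (2 * u))) (mul_pos hc' hc)
      simpa only [div_div] using this) (u := 1 / 2) (by norm_num) (by norm_num)
  convert h using 2
  field_simp

/-! ### A nonzero function with a transform. -/

theorem exists_hasStarTransform_ne_zero (μ : ℝ) :
    ∃ V : ℝ → ℂ, HasStarTransform μ V ∧ ∃ u : ℝ, 0 < u ∧ V u ≠ 0 := by
  set W : ℂ → ℂ := fun s => (Icc (0 : ℝ) 1).indicator 1 s.im with hW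
  set V : ℝ → ℂ := fun u => (2 * Real.pi * Complex.I)⁻¹ *
    verticalIntegral 2 (fun s => W s * starKernel μ s u)
  have hWline (t : ℝ) : W ((2 : ℝ) + t * Complex.I) = (Icc (0 : ℝ) 1).indicator 1 t := by
    simp [hW]
  have h : IsStarTransform μ V 2 W := by
    refine ⟨by norm_num, ⟨1, one_pos, ?_⟩, fun u _ _ => rfl⟩
    have hcont : Continuous fun t : ℝ =>
        ((‖((2 : ℝ) : ℂ) + t * Complex.I‖ ^ (3 / 2 + (1 : ℝ)) : ℝ) : ℂ) :=
      Complex.continuous_ofReal.comp ((by fun_prop : Continuous fun t : ℝ =>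
        ‖((2 : ℝ) : ℂ) + t * Complex.I‖).rpow_const fun _ => Or.inr (by norm_num))
    have hi := (hcont.continuousOn (s := Icc 0 1)).integrableOn_Icc.integrable_indicator
      measurableSet_Icc (μ := volume)
    refine hi.congr (Eventually.of_forall fun t => ?_)
    simp only [hWline]
    by_cases ht : t ∈ Icc (0 : ℝ) 1 <;> simp [ht]
  refine ⟨V, ⟨2, W, h⟩, ?_⟩
  by_contra! hV
  obtain ⟨g, hg, hg0, hsum⟩ := h.exists_moment_expansion
  have hzero := eq_zero_of_hasSum_zero_on_Ioo one_pos (γ := fun n => halfCoeff μ n *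
    ∫ τ in Ioc (0 : ℝ) 1, (τ : ℂ) ^ n * g τ) fun x hx0 hx1 => by
      have hx : (√x : ℂ) ^ 2 = x := by exact_mod_cast Real.sq_sqrt hx0.le
      have h1 := hsum √x (Real.sqrt_pos.2 hx0) ((Real.sqrt_lt' one_pos).2 (by simpa using hx1))
      rwa [hx, hV _ (Real.sqrt_pos.2 hx0), mul_zero, zero_mul] at h1
  -- The zeroth moment equals the integral of `W` along the line, which is `1`.
  have h0 := congrFun hzero 0
  simp only [hWline] at hg0
  rw [integral_indicator measurableSet_Icc] at hg0
  simp [hg0, halfCoeff_ne_zero] at h0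

end StarTransform

theorem corollary4p2 (μ : ℝ) :
    (∀ V : ℝ → ℂ, (∀ c : ℝ, 0 < c → HasStarTransform μ (fun u => V (u / c))) →
      ∀ u : ℝ, 0 < u → V u = 0) ∧
    (∃ V : ℝ → ℂ, HasStarTransform μ V ∧
      ∃ c : ℝ, 0 < c ∧ ¬ HasStarTransform μ (fun u => V (u / c))) := by
  refine ⟨fun V hV u hu => eq_zero_of_forall_dilate_hasStarTransform hV hu, ?_⟩
  obtain ⟨V, hV, u, hu, hne⟩ := exists_hasStarTransform_ne_zero μ
  refine ⟨V, hV, ?_⟩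
  by_contra! h
  exact hne (eq_zero_of_forall_dilate_hasStarTransform h hu)
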